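/- Let $\Sigma=\{0,1\}$ and let $\Sigma^*$ be the set of all finite words over $\Sigma$. A word is *cubefree* if it has no factor (contiguous subword) that is a non-empty word of the form $xxx$. A morphism $h:\Sigma^*\to\Sigma^*$ (a map with $h(uv)=h(u)h(v)$ for all words $u,v$) is *$k$-uniform* if $h(a)$ has length $k$ for every letter $a\in\Sigma$, and it is *cubefree* if $h(w)$ is cubefree whenever $w\in\Sigma^*$ is cubefree. For every integer $k\ge 0$ there exists a $k$-uniform cubefree morphism $h:\Sigma^*\to\Sigma^*$. -/

import Mathlib

/-- `u` is a factor (contiguous subword) of the word `w`. -/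
def IsFactor {α : Type*} (u w : FreeMonoid α) : Prop :=
  ∃ p s : FreeMonoid α, w = p * u * s

/-- A cube is a non-empty word of the form `x x x`. -/
def IsCube {α : Type*} (u : FreeMonoid α) : Prop :=
  u ≠ 1 ∧ ∃ x : FreeMonoid α, u = x * x * x

/-- A word is cubefree if none of its factors is a cube. -/
def IsCubefreeWord {α : Type*} (w : FreeMonoid α) : Prop :=
  ∀ u : FreeMonoid α, IsFactor u w → ¬ IsCube u

/-- A morphism `h` is `k`-uniform if the image of every letter has length `k`. -/
def IsUniformMorphism {α : Type*} (k : ℕ) (h : FreeMonoid α →* FreeMonoid α) : Prop :=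
  ∀ a : α, (h (FreeMonoid.of a)).length = k

/-- A morphism is cubefree if it maps cubefree words to cubefree words. -/
def IsCubefreeMorphism {α : Type*} (h : FreeMonoid α →* FreeMonoid α) : Prop :=
  ∀ w : FreeMonoid α, IsCubefreeWord w → IsCubefreeWord (h w)

/-! Cubefree morphisms compose and their uniform lengths multiply, so apart from `k = 0, 1` only
primes matter; those below 44 and all `k ≥ 44` are treated separately.

For a prime below 44 an explicit pair of images passes a finite test. Cubes of short period are
visible in images of short cubefree words. For a long period, synchronization (a few letters
determine their position modulo `k`) forces `k` to divide the period, and such a cube pulls back to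
the original word (`not_isCubeAt_uniformImage_of_dvd`).

For `k ≥ 44` the two images are different headers of 11 letters followed by the same Thue–Morse
factor of length `k - 11`. The headers share their first seven letters, the marker. It contains an
overlap, so it never occurs inside the overlap-free Thue–Morse part (`thueMorse_not_overlap`) and
marks the starts of blocks. A cube of period above 10 contains a marker, so that `k` divides its
period, or else it puts an overlap into a Thue–Morse part. A cube of period at most 10 that meets a
header lies in a bounded window around it. If the Thue–Morse factor ends at a multiple of 32, only
64 surroundings of a header arise, and suitable headers are listed for each. -/

/-! ### Cubes in images under uniform morphisms -/

/-- The letters of `f` from `i` to `i + 3 * p` form a cube of period `p`. -/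
def IsCubeAt (f : ℕ → Bool) (p i : ℕ) : Prop :=
  ∀ j < 2 * p, f (i + j) = f (i + j + p)

/-- The first `n` letters of `f` form a cubefree word. -/
def CubefreeBelow (f : ℕ → Bool) (n : ℕ) : Prop :=
  ∀ p i, 0 < p → i + 3 * p ≤ n → ¬ IsCubeAt f p i

/-- The image of the word `w` under the `k`-uniform morphism that sends the letter `c` to the
first `k` letters of `A c`. -/
def uniformImage (A : Bool → ℕ → Bool) (k : ℕ) (w : ℕ → Bool) : ℕ → Bool :=
  fun i => A (w (i / k)) (i % k)

theorem uniformImage_mul_add (A : Bool → ℕ → Bool) {k : ℕ} (w : ℕ → Bool) (q : ℕ) {d : ℕ}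
    (hd : d < k) : uniformImage A k w (k * q + d) = A (w q) d := by
  have h1 : (k * q + d) / k = q := by
    rw [Nat.mul_add_div (by omega), Nat.div_eq_of_lt hd, add_zero]
  have h2 : (k * q + d) % k = d := by
    rw [Nat.mul_add_mod, Nat.mod_eq_of_lt hd]
  simp only [uniformImage, h1, h2]

/-- If the images of the two letters differ, a cube in the image of a word whose period is a
multiple of `k` comes from a cube in the word. -/
theorem not_isCubeAt_uniformImage_of_dvd {A : Bool → ℕ → Bool} {k : ℕ}
    (hA : ∃ d < k, A false d ≠ A true d) {w : ℕ → Bool} {n : ℕ} (hw : CubefreeBelow w n)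
    {p i : ℕ} (hp : 0 < p) (hi : i + 3 * p ≤ k * n) (hkp : k ∣ p) :
    ¬ IsCubeAt (uniformImage A k w) p i := by
  obtain ⟨d, hd, hne⟩ := hA
  obtain ⟨m, rfl⟩ := hkp
  intro hc
  have hm : 0 < m := Nat.pos_of_mul_pos_left hp
  have hinj : ∀ a b, A a d = A b d → a = b := by
    intro a b h
    cases a <;> cases b <;> simp_all
  -- The letters at places `k * q + d` determine the word, so sampling there turns period `k * m`
  -- into period `m`.
  have hpull : ∀ q, i ≤ k * q + d → k * q + d < i + k → IsCubeAt w m q := by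
    intro q h1 h2 e he
    have h3 : k * (e + 1) ≤ k * (2 * m) := Nat.mul_le_mul_left k he
    have h4 := hc (k * (q + e) + d - i) (by
      have : k * (2 * m) = 2 * (k * m) := by ring
      rw [Nat.mul_add] at *
      omega)
    have h5 : i + (k * (q + e) + d - i) = k * (q + e) + d := by
      rw [Nat.mul_add]; omega
    have h6 : k * (q + e) + d + k * m = k * (q + e + m) + d := by ring
    rw [h5, h6, uniformImage_mul_add A w _ hd, uniformImage_mul_add A w _ hd] at h4
    exact hinj _ _ h4
  have hk : 0 < k := by omega
  have hr : i % k < k := Nat.mod_lt _ hk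
  have hdm := Nat.div_add_mod i k
  by_cases h : i % k ≤ d
  · refine hw m (i / k) hm ?_ (hpull _ (by omega) (by omega))
    refine Nat.le_of_mul_le_mul_left ?_ hk
    have : k * (i / k + 3 * m) = k * (i / k) + 3 * (k * m) := by ring
    omega
  -- The first sampled place lies in the next block. Here `i` is not a multiple of `k`, which makes
  -- the bound below strict and leaves room for the shift by one.
  · have e1 : k * (i / k + 1) = k * (i / k) + k := by ring
    refine hw m (i / k + 1) hm ?_ (hpull _ (by omega) (by omega))
    have : i / k + 3 * m < n := by
      refine Nat.lt_of_mul_lt_mul_left (a := k) ?_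
      have : k * (i / k + 3 * m) = k * (i / k) + 3 * (k * m) := by ring
      omega
    omega

/-! ### Finite tests on words coded as binary numbers, first letter in the lowest digit -/

/-- The binary digits of `v` at the places `i, …, i + l - 1`, as a number. -/
def bitSlice (v i l : ℕ) : ℕ := v / 2 ^ i % 2 ^ l

theorem bitSlice_eq_iff {v v' i i' l : ℕ} :
    bitSlice v i l = bitSlice v' i' l ↔ ∀ j < l, v.testBit (i + j) = v'.testBit (i' + j) := by
  constructor
  · intro h j hj
    have := congrArg (fun x => x.testBit j) h
    simpa [bitSlice, Nat.testBit_mod_two_pow, Nat.testBit_div_two_pow, hj, add_comm] using this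
  · intro h
    refine Nat.eq_of_testBit_eq fun j => ?_
    by_cases hj : j < l
    · simpa [bitSlice, Nat.testBit_mod_two_pow, Nat.testBit_div_two_pow, hj, add_comm]
        using h j hj
    · simp [bitSlice, Nat.testBit_mod_two_pow, hj]

/-- The digit `i` of `runMask x l` is one if the digits `i, …, i + l` of `x` are. -/
def runMask (x : ℕ) : ℕ → ℕ
  | 0 => x
  | l + 1 => Nat.land x (runMask x l / 2)

theorem testBit_runMask (x l i : ℕ) :
    (runMask x l).testBit i = true ↔ ∀ j ≤ l, x.testBit (i + j) = true := by
  induction l generalizing i with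
  | zero => simp [runMask]
  | succ l ih =>
    change (x &&& runMask x l / 2).testBit i = true ↔ _
    rw [Nat.testBit_and, Nat.testBit_div_two, Bool.and_eq_true, ih]
    constructor
    · rintro ⟨h0, h⟩ j hj
      rcases j with _ | j
      · exact h0
      · have := h j (by omega)
        rwa [add_right_comm] at this
    · intro h
      refine ⟨h 0 (by omega), fun j hj => ?_⟩
      rw [add_right_comm]
      exact h (j + 1) (by omega)

/-- No `m + 1` consecutive digits of `x` and `y` at the same places below `n` agree. -/
def noCommonRun (n x y m : ℕ) : Bool :=
  Nat.beq (runMask (Nat.xor (2 ^ n - 1) (Nat.xor x y % 2 ^ n)) m) 0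

theorem noCommonRun_iff {n x y m : ℕ} : noCommonRun n x y m = true ↔
    ∀ i, i + m < n → ∃ j ≤ m, x.testBit (i + j) ≠ y.testBit (i + j) := by
  -- The mask is the complement of `x xor y` below `n`: its ones are the places of agreement.
  have key : ∀ i, (Nat.xor (2 ^ n - 1) (Nat.xor x y % 2 ^ n)).testBit i = true ↔
      i < n ∧ x.testBit i = y.testBit i := by
    intro i
    change ((2 ^ n - 1) ^^^ ((x ^^^ y) % 2 ^ n)).testBit i = true ↔ _
    rw [Nat.testBit_xor, Nat.testBit_two_pow_sub_one, Nat.testBit_mod_two_pow, Nat.testBit_xor]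
    by_cases h : i < n
    · cases hx : x.testBit i <;> cases hy : y.testBit i <;> simp [h]
    · simp [h]
  rw [noCommonRun, Nat.beq_eq]
  constructor
  · intro h i hi
    by_contra! hc
    have : (runMask (Nat.xor (2 ^ n - 1) (Nat.xor x y % 2 ^ n)) m).testBit i = true :=
      (testBit_runMask _ _ _).mpr fun j hj => (key _).mpr ⟨by omega, hc j hj⟩
    rw [h, Nat.zero_testBit] at this
    exact Bool.false_ne_true this
  · intro h
    refine Nat.eq_of_testBit_eq fun i => ?_
    rw [Nat.zero_testBit, Bool.eq_false_iff]
    intro hi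
    rw [testBit_runMask] at hi
    have hi' := fun j hj => (key _).mp (hi j hj)
    obtain ⟨j, hj, hne⟩ := h i (hi' m le_rfl).1
    exact hne (hi' j hj).2

/-- The first `n` binary digits of `v` contain no cube of period at most `P`. -/
def cubefreeBits (v n P : ℕ) : Bool :=
  (List.range P).all fun p => noCommonRun (n - (p + 1)) v (v / 2 ^ (p + 1)) (2 * p + 1)

theorem cubefreeBits_iff {v n P : ℕ} :
    cubefreeBits v n P = true ↔
      ∀ p i, 0 < p → p ≤ P → i + 3 * p ≤ n → ¬ IsCubeAt v.testBit p i := by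
  simp only [cubefreeBits, List.all_eq_true, List.mem_range, noCommonRun_iff,
    Nat.testBit_div_two_pow, IsCubeAt]
  constructor
  · intro h p i hp hP hi hc
    obtain ⟨p, rfl⟩ : ∃ r, p = r + 1 := ⟨p - 1, by omega⟩
    obtain ⟨j, hj, hne⟩ := h p (by omega) i (by omega)
    exact hne (hc j (by omega))
  · intro h p hp i hi
    have := h (p + 1) i (by omega) (by omega) (by omega)
    push Not at this
    obtain ⟨j, hj, hne⟩ := this
    exact ⟨j, by omega, hne⟩

theorem IsCubeAt.congr {f g : ℕ → Bool} {p i i' : ℕ} (h : IsCubeAt f p i)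
    (hfg : ∀ j < 3 * p, f (i + j) = g (i' + j)) : IsCubeAt g p i' := by
  intro j hj
  rw [← hfg j (by omega), h j hj, add_assoc, hfg (j + p) (by omega), add_assoc]

theorem exists_bits (w : ℕ → Bool) (q l : ℕ) :
    ∃ v < 2 ^ l, ∀ j < l, v.testBit j = w (q + j) :=
  ⟨Nat.ofBits fun j : Fin l => w (q + j), Nat.ofBits_lt_two_pow _, fun j hj => by
    rw [Nat.testBit_ofBits_lt _ _ hj]⟩

/-- The image of the `l`-letter word with digits `v` under `0 ↦ a`, `1 ↦ b`, where `a` and `b`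
are read as `k`-letter words. -/
def bitImage (k a b : ℕ) : ℕ → ℕ → ℕ
  | 0, _ => 0
  | l + 1, v => 2 ^ k * bitImage k a b l (v / 2) + bif v.testBit 0 then b else a

theorem testBit_bitImage {k a b : ℕ} (ha : a < 2 ^ k) (hb : b < 2 ^ k) (l : ℕ) :
    ∀ v q d, q < l → d < k →
      (bitImage k a b l v).testBit (k * q + d) = (bif v.testBit q then b else a).testBit d := by
  induction l with
  | zero => intro v q d hq; omega
  | succ l ih =>
    intro v q d hq hd
    have hlt : (bif v.testBit 0 then b else a) < 2 ^ k := by cases v.testBit 0 <;> assumption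
    rw [bitImage, Nat.testBit_two_pow_mul_add _ hlt]
    rcases q with _ | q
    · simp [hd]
    · have h1 : k * (q + 1) + d = k * q + d + k := by ring
      rw [if_neg (by omega), h1, Nat.add_sub_cancel, ih _ _ _ (by omega) hd,
        Nat.testBit_succ]

/-- The images of the cubefree words of length at most `L`, with their lengths. -/
def cubefreeImages (k a b L : ℕ) : List (ℕ × ℕ) :=
  (List.range (L + 1)).flatMap fun l =>
    ((List.range (2 ^ l)).filter fun v => cubefreeBits v l l).map fun v =>
      (k * l, bitImage k a b l v)

/-- A finite test: images of cubefree words of length at most `L` have no cube of period less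
than `m`, and `m` consecutive letters of the image of a cubefree word of length at most `M`
determine their position modulo `k`. -/
def uniformCheck (k m L M a b : ℕ) : Bool :=
  decide (a < 2 ^ k) && decide (b < 2 ^ k) && decide (a ≠ b) &&
  (cubefreeImages k a b L).all (fun x => cubefreeBits x.2 x.1 (m - 1)) &&
  (cubefreeImages k a b M).all (fun x => (cubefreeImages k a b M).all fun y =>
    (List.range (k - 1)).all fun d =>
      noCommonRun (min x.1 (y.1 - (d + 1))) x.2 (y.2 / 2 ^ (d + 1)) (m - 1))

theorem exists_testBit_ne {k a b : ℕ} (ha : a < 2 ^ k) (hb : b < 2 ^ k) (hab : a ≠ b) :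
    ∃ d < k, a.testBit d ≠ b.testBit d := by
  by_contra! h
  refine hab (Nat.eq_of_testBit_eq fun d => ?_)
  by_cases hd : d < k
  · exact h d hd
  · have : 2 ^ k ≤ 2 ^ d := Nat.pow_le_pow_right (by norm_num) (by omega)
    rw [Nat.testBit_lt_two_pow (by omega), Nat.testBit_lt_two_pow (by omega)]

/-- A cube of period at most `m - 1` starts at offset at most `k - 1` in its block, so it ends
within `k + 3 * m - 4` letters; `hL` fits it into `L` blocks. For a longer period the first `m`
letters of the cube recur `p` places later, and synchronization gives `k ∣ p`; `hL'` fits any `m`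
letters into `M` blocks. -/
theorem cubefreeBelow_uniformImage_of_check {k m L M a b : ℕ} (hm : 0 < m)
    (hL : k + 3 * m ≤ k * L + 4) (hL' : k + m ≤ k * M + 1)
    (h : uniformCheck k m L M a b = true) {w : ℕ → Bool} {n : ℕ} (hw : CubefreeBelow w n) :
    CubefreeBelow (uniformImage (fun c => (bif c then b else a).testBit) k w) (k * n) := by
  simp only [uniformCheck, cubefreeImages, Bool.and_eq_true, decide_eq_true_eq, List.all_eq_true,
    List.mem_flatMap, List.mem_map, List.mem_filter, List.mem_range] at h
  obtain ⟨⟨⟨⟨ha, hb⟩, hab⟩, hcube⟩, hsync⟩ := h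
  obtain ⟨d, hd, hne⟩ := exists_testBit_ne ha hb hab
  have hk : 0 < k := by omega
  set g := uniformImage (fun c => (bif c then b else a).testBit) k w with hg
  -- Near the end of the word fewer than `L` letters remain, which is why the test covers all
  -- lengths up to `L`.
  have window : ∀ L q, q ≤ n → ∃ l v, l = min L (n - q) ∧ v < 2 ^ l ∧ cubefreeBits v l l = true ∧
      ∀ e < k * l, (bitImage k a b l v).testBit e = g (k * q + e) := by
    intro L q hq
    obtain ⟨v, hv, hvw⟩ := exists_bits w q (min L (n - q))
    refine ⟨_, v, rfl, hv, ?_, ?_⟩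
    · rw [cubefreeBits_iff]
      intro p i hp _ hi hc
      refine hw p (q + i) hp (by omega) (hc.congr fun j hj => ?_)
      rw [hvw _ (by omega), add_assoc]
    · intro e he
      have h1 : e / k < min L (n - q) := Nat.div_lt_of_lt_mul he
      have h2 := Nat.mod_lt e hk
      have h3 : k * q + e = k * (q + e / k) + e % k := by
        rw [Nat.mul_add, add_assoc, Nat.div_add_mod]
      rw [h3, hg, uniformImage_mul_add _ _ _ h2, ← hvw _ h1,
        ← testBit_bitImage ha hb _ _ _ _ h1 h2, Nat.div_add_mod]
  have reach : ∀ L i r, i % k + r ≤ k * L → i + r ≤ k * n → 0 < r →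
      i / k ≤ n ∧ i % k + r ≤ k * min L (n - i / k) := by
    intro L i r h1 h2 hr
    have h3 := Nat.div_add_mod i k
    have h4 : i / k ≤ n := by
      refine Nat.le_of_mul_le_mul_left ?_ hk
      omega
    refine ⟨h4, ?_⟩
    rcases min_choice L (n - i / k) with h5 | h5 <;> rw [h5]
    · exact h1
    · rw [Nat.mul_sub]; omega
  intro p i hp hi hc
  have hr := Nat.mod_lt i hk
  have h3 := Nat.div_add_mod i k
  by_cases hpm : p < m
  · obtain ⟨h4, h5⟩ := reach L i (3 * p) (by omega) hi (by omega)
    obtain ⟨l, v, rfl, hv, hvc, hvg⟩ := window L (i / k) h4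
    have := hcube _ ⟨min L (n - i / k), by omega, v, ⟨hv, hvc⟩, rfl⟩
    rw [cubefreeBits_iff] at this
    refine this p (i % k) hp (by omega) h5 (hc.congr fun j hj => ?_)
    rw [hvg _ (by omega), ← add_assoc, h3]
  · refine not_isCubeAt_uniformImage_of_dvd ⟨d, hd, by simpa using hne⟩ hw hp hi ?_ hc
    have slices : ∀ z, i ≤ z → z ≤ i + p → ∃ l v, l < M + 1 ∧ (v < 2 ^ l ∧ cubefreeBits v l l = true)
        ∧ z % k + m ≤ k * l ∧ ∀ e < k * l, (bitImage k a b l v).testBit e = g (k * (z / k) + e) := by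
      intro z hz hz'
      have := Nat.mod_lt z hk
      obtain ⟨h4, h5⟩ := reach M z m (by omega) (by omega) hm
      obtain ⟨l, v, rfl, hv, hvc, hvg⟩ := window M (z / k) h4
      exact ⟨_, v, by omega, ⟨hv, hvc⟩, h5, hvg⟩
    have distinct : ∀ z z', i ≤ z → z ≤ i + p → i ≤ z' → z' ≤ i + p → z % k < z' % k →
        ∃ j < m, g (z + j) ≠ g (z' + j) := by
      intro z z' h1 h2 h1' h2' hlt
      obtain ⟨l, v, hl, hv, h5, hvg⟩ := slices z h1 h2
      obtain ⟨l', v', hl', hv', h5', hvg'⟩ := slices z' h1' h2'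
      obtain ⟨j, hj, hne⟩ := noCommonRun_iff.mp (hsync _ ⟨l, hl, v, hv, rfl⟩ _
        ⟨l', hl', v', hv', rfl⟩ (z' % k - z % k - 1) (by have := Nat.mod_lt z' hk; omega))
        (z % k) (by simp only; omega)
      refine ⟨j, by omega, ?_⟩
      rwa [Nat.testBit_div_two_pow,
        show z % k + j + (z' % k - z % k - 1 + 1) = z' % k + j by omega, hvg _ (by omega),
        hvg' _ (by omega), ← add_assoc, ← add_assoc, Nat.div_add_mod, Nat.div_add_mod] at hne
    have hmod : i % k = (i + p) % k := by
      by_contra hne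
      rcases Nat.lt_or_gt_of_ne hne with h | h
      · obtain ⟨j, hj, hne⟩ := distinct i (i + p) (by omega) (by omega) (by omega) (by omega) h
        exact hne (by rw [hc j (by omega), add_right_comm])
      · obtain ⟨j, hj, hne⟩ := distinct (i + p) i (by omega) (by omega) (by omega) (by omega) h
        exact hne (by rw [hc j (by omega), add_right_comm])
    have : (i + 0) ≡ i + p [MOD k] := hmod
    exact (Nat.modEq_zero_iff_dvd.mp (Nat.ModEq.add_left_cancel' i this).symm)

/-! ### The Thue–Morse sequence and its overlap-freeness -/

/-- The Thue–Morse sequence. -/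
def thueMorse : ℕ → Bool
  | 0 => false
  | n + 1 => xor (thueMorse ((n + 1) / 2)) (decide ((n + 1) % 2 = 1))
decreasing_by omega

theorem thueMorse_two_mul (n : ℕ) : thueMorse (2 * n) = thueMorse n := by
  rcases n with _ | n
  · rfl
  · have h1 : 2 * (n + 1) = (2 * n + 1) + 1 := by ring
    have h2 : (2 * n + 1 + 1) / 2 = n + 1 := by omega
    have h3 : (2 * n + 1 + 1) % 2 = 0 := by omega
    rw [h1, thueMorse, h2, h3]
    simp

theorem thueMorse_two_mul_add_one (n : ℕ) : thueMorse (2 * n + 1) = !thueMorse n := by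
  have h2 : (2 * n + 1) / 2 = n := by omega
  have h3 : (2 * n + 1) % 2 = 1 := by omega
  rw [thueMorse, h2, h3]
  simp

theorem thueMorse_two_pow_mul_add (l q : ℕ) :
    ∀ r < 2 ^ l, thueMorse (2 ^ l * q + r) = xor (thueMorse q) (thueMorse r) := by
  induction l with
  | zero =>
    intro r hr
    obtain rfl : r = 0 := by simpa using hr
    simp [thueMorse]
  | succ l ih =>
    intro r hr
    have hr' : r / 2 < 2 ^ l := by rw [pow_succ] at hr; omega
    have h1 : 2 ^ (l + 1) * q + r = 2 * (2 ^ l * q + r / 2) + r % 2 := by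
      rw [pow_succ]
      have := Nat.div_add_mod r 2
      linarith
    rw [h1]
    conv_rhs => rw [← Nat.div_add_mod r 2]
    rcases Nat.mod_two_eq_zero_or_one r with h | h <;> rw [h]
    · simp only [add_zero, thueMorse_two_mul, ih _ hr']
    · simp only [thueMorse_two_mul_add_one, ih _ hr', Bool.xor_not]

/-- The Thue–Morse sequence is overlap-free. -/
theorem thueMorse_not_overlap (p : ℕ) :
    ∀ i, 0 < p → ∃ j ≤ p, thueMorse (i + j) ≠ thueMorse (i + j + p) := by
  have step : ∀ n, n % 2 = 0 → thueMorse n ≠ thueMorse (n + 1) := by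
    intro n hn
    obtain ⟨m, rfl⟩ : ∃ m, n = 2 * m := ⟨n / 2, by omega⟩
    rw [thueMorse_two_mul, thueMorse_two_mul_add_one]
    simp
  -- Five alternating letters have three equal letters at places of one parity; halving these places
  -- gives three equal consecutive letters, one adjacent pair of which starts at an even place.
  have no_four : ∀ i, thueMorse i ≠ thueMorse (i + 1) → thueMorse (i + 1) ≠ thueMorse (i + 2) →
      thueMorse (i + 2) ≠ thueMorse (i + 3) → thueMorse (i + 3) ≠ thueMorse (i + 4) → False := by
    intro i h1 h2 h3 h4
    have e1 : thueMorse i = thueMorse (i + 2) := by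
      revert h1 h2; cases thueMorse i <;> cases thueMorse (i + 1) <;> simp
    have e2 : thueMorse (i + 2) = thueMorse (i + 4) := by
      revert h3 h4; cases thueMorse (i + 2) <;> cases thueMorse (i + 3) <;> simp
    have key : ∀ a, thueMorse a = thueMorse (a + 1) → thueMorse (a + 1) = thueMorse (a + 2) →
        False := by
      intro a h h'
      rcases Nat.mod_two_eq_zero_or_one a with h0 | h0
      · exact step a h0 h
      · exact step (a + 1) (by omega) h'
    obtain ⟨a, h | h⟩ : ∃ a, i = 2 * a ∨ i = 2 * a + 1 := ⟨i / 2, by omega⟩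
    · subst h
      rw [show 2 * a + 2 = 2 * (a + 1) by ring, show 2 * a + 4 = 2 * (a + 2) by ring,
        thueMorse_two_mul, thueMorse_two_mul] at *
      exact key a e1 e2
    · subst h
      rw [show 2 * a + 1 + 2 = 2 * (a + 1) + 1 by ring, show 2 * a + 1 + 4 = 2 * (a + 2) + 1 by ring,
        thueMorse_two_mul_add_one, thueMorse_two_mul_add_one] at *
      exact key a (by simpa using e1) (by simpa using e2)
  induction p using Nat.strong_induction_on with
  | _ p ih =>
    intro i hp
    by_contra! hov
    obtain ⟨q, h | h⟩ : ∃ q, p = 2 * q ∨ p = 2 * q + 1 := ⟨p / 2, by omega⟩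
    -- For an even period the places of the parity of `i` carry an overlap of half the period.
    · subst h
      obtain ⟨a, h | h⟩ : ∃ a, i = 2 * a ∨ i = 2 * a + 1 := ⟨i / 2, by omega⟩
      · obtain ⟨j, hj, hne⟩ := ih q (by omega) a (by omega)
        have := hov (2 * j) (by omega)
        rw [h, show 2 * a + 2 * j + 2 * q = 2 * (a + j + q) by ring,
          show 2 * a + 2 * j = 2 * (a + j) by ring, thueMorse_two_mul, thueMorse_two_mul] at this
        exact hne this
      · obtain ⟨j, hj, hne⟩ := ih q (by omega) a (by omega)
        have := hov (2 * j) (by omega)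
        rw [h, show 2 * a + 1 + 2 * j + 2 * q = 2 * (a + j + q) + 1 by ring,
          show 2 * a + 1 + 2 * j = 2 * (a + j) + 1 by ring, thueMorse_two_mul_add_one,
          thueMorse_two_mul_add_one] at this
        exact hne (by simpa using this)
    -- As `p` is odd, one of `i + j` and `i + j + p` is even; the letter changes there, and the
    -- overlap carries the change to the other place.
    · have alt : ∀ j < p, thueMorse (i + j) ≠ thueMorse (i + j + 1) ∧
          thueMorse (i + j + p) ≠ thueMorse (i + j + p + 1) := by
        intro j hj
        have e1 := hov j (by omega)
        have e2 := hov (j + 1) (by omega)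
        rw [← add_assoc, add_right_comm _ 1 p] at e2
        rcases Nat.mod_two_eq_zero_or_one (i + j) with h0 | h0
        · have := step _ h0
          exact ⟨this, by rwa [← e1, ← e2]⟩
        · have := step (i + j + p) (by omega)
          exact ⟨by rwa [e1, e2], this⟩
      have alt' : ∀ j < 2 * p, thueMorse (i + j) ≠ thueMorse (i + j + 1) := by
        intro j hj
        by_cases hjp : j < p
        · exact (alt j hjp).1
        · have := (alt (j - p) (by omega)).2
          rwa [show i + (j - p) + p = i + j by omega] at this
      -- Period 1 gives an alternating stretch too short for `no_four`, but then the overlap itself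
      -- has equal neighbours.
      rcases Nat.eq_zero_or_pos q with hq | hq
      · subst hq
        have e1 := hov 0 (by omega)
        have := alt' 0 (by omega)
        simp only [h] at e1
        exact this e1
      · exact no_four i (alt' 0 (by omega)) (alt' 1 (by omega)) (alt' 2 (by omega))
          (alt' 3 (by omega))

theorem thueMorse_eq_testBit {n : ℕ} (hn : n < 64) :
    thueMorse n = (0x6996966996696996 : ℕ).testBit n := by
  have h : ∀ r < 32, (0x6996966996696996 : ℕ).testBit (2 * r) =
      (0x6996966996696996 : ℕ).testBit r ∧ (0x6996966996696996 : ℕ).testBit (2 * r + 1) =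
      !(0x6996966996696996 : ℕ).testBit r := by decide
  induction n using Nat.strong_induction_on with
  | _ n ih =>
    rcases Nat.eq_zero_or_pos n with h0 | h0
    · subst h0; simp [thueMorse]
    · obtain ⟨m, h1 | h1⟩ : ∃ m, n = 2 * m ∨ n = 2 * m + 1 := ⟨n / 2, by omega⟩ <;> subst h1
      · rw [thueMorse_two_mul, ih m (by omega) (by omega), (h m (by omega)).1]
      · rw [thueMorse_two_mul_add_one, ih m (by omega) (by omega), (h m (by omega)).2]

/-! ### Headers, markers and blocks for `k ≥ 44` -/

/-- The 71 letters around a header `H` of 11 letters, when the Thue–Morse factor before it ends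
with the image under the fifth power of the Thue–Morse morphism of the letter `a`, and the
Thue–Morse factor after it starts at the place `s`. -/
def headerWindow (s : ℕ) (a : Bool) (H : ℕ) : ℕ :=
  2 ^ 30 * (2 ^ 11 * (0x6996966996696996 / 2 ^ s % 2 ^ 30) + H) +
    (bif a then 0x69969669 else 0x96696996) / 2 ^ 2

theorem testBit_headerWindow_left (s : ℕ) (a : Bool) (H : ℕ) {j : ℕ} (hj : j < 30) :
    (headerWindow s a H).testBit j = xor a (thueMorse (j + 2)) := by
  have h : ∀ a : Bool, ∀ j < 30, ((bif a then 0x69969669 else 0x96696996) / 2 ^ 2 : ℕ).testBit j =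
      xor a ((0x6996966996696996 : ℕ).testBit (j + 2)) := by decide
  rw [headerWindow, Nat.testBit_two_pow_mul_add _ (by cases a <;> norm_num), if_pos hj, h a j hj,
    thueMorse_eq_testBit (by omega)]

theorem testBit_headerWindow_middle (s : ℕ) (a : Bool) {H : ℕ} (hH : H < 2 ^ 11) {j : ℕ}
    (hj : j < 11) : (headerWindow s a H).testBit (30 + j) = H.testBit j := by
  rw [headerWindow, Nat.testBit_two_pow_mul_add _ (by cases a <;> norm_num), if_neg (by omega),
    Nat.add_sub_cancel_left, Nat.testBit_two_pow_mul_add _ hH, if_pos hj]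

theorem testBit_headerWindow_right {s : ℕ} (hs : s < 32) (a : Bool) {H : ℕ} (hH : H < 2 ^ 11)
    {j : ℕ} (hj : j < 30) : (headerWindow s a H).testBit (41 + j) = thueMorse (s + j) := by
  rw [headerWindow, Nat.testBit_two_pow_mul_add _ (by cases a <;> norm_num), if_neg (by omega),
    show 41 + j - 30 = 11 + j by omega, Nat.testBit_two_pow_mul_add _ hH, if_neg (by omega),
    Nat.add_sub_cancel_left, Nat.testBit_mod_two_pow, Nat.testBit_div_two_pow,
    thueMorse_eq_testBit (by omega), add_comm j s]
  simp [hj]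

/-- A finite test for the pair of headers `H.1`, `H.2`: their common first seven letters contain
an overlap and occur only once in the window around a header, and such a window has no cube of
period at most ten. -/
def headerCheck (s : ℕ) (a : Bool) (H : ℕ × ℕ) : Bool :=
  decide (H.1 < 2 ^ 11) && decide (H.2 < 2 ^ 11) && decide (H.1 ≠ H.2) &&
  decide (bitSlice H.1 0 7 = bitSlice H.2 0 7) &&
  (List.range 3).any (fun p => (List.range (7 - (2 * p + 2))).any fun i =>
    bitSlice H.1 i (p + 2) == bitSlice H.1 (i + (p + 1)) (p + 2)) &&
  [H.1, H.2].all fun h => cubefreeBits (headerWindow s a h) 71 10 &&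
    (List.range 65).all fun z =>
      decide (z = 30) || bitSlice (headerWindow s a h) z 7 != bitSlice h 0 7

/-- Headers such that every pair `s`, `a` passes the test with one of them. -/
def headers : List (ℕ × ℕ) :=
  [(1238, 726), (297, 809), (1238, 1750), (1321, 809), (310, 1334), (1610, 842), (841, 713),
    (310, 822), (402, 1426), (1334, 1206), (1225, 1737)]

theorem exists_headerCheck : ∀ s < 32, ∀ a : Bool, ∃ H ∈ headers, headerCheck s a H = true := by
  decide +kernel

theorem bitSlice_zero_ext {v v' l : ℕ} (h : bitSlice v 0 l = bitSlice v' 0 l) {j : ℕ}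
    (hj : j < l) : v.testBit j = v'.testBit j := by
  simpa using bitSlice_eq_iff.mp h j hj

/-- The words `H ++ t`, where `H` is one of two headers and `t` is the factor of the Thue–Morse
sequence that starts at the place `s`. -/
def headerBlock (s : ℕ) (H : ℕ × ℕ) (c : Bool) (d : ℕ) : Bool :=
  if d < 11 then (bif c then H.2 else H.1).testBit d else thueMorse (s + (d - 11))

section

variable {s n : ℕ} {H : ℕ × ℕ}

theorem uniformImage_headerBlock_tail (w : ℕ → Bool) (q : ℕ) {j : ℕ} (hj : j < n) :
    uniformImage (headerBlock s H) (11 + n) w ((11 + n) * q + 11 + j) = thueMorse (s + j) := by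
  rw [add_assoc, uniformImage_mul_add _ _ _ (by omega), headerBlock, if_neg (by omega),
    Nat.add_sub_cancel_left]

theorem uniformImage_headerBlock_head (w : ℕ → Bool) (q : ℕ) {j : ℕ} (hj : j < 11) :
    uniformImage (headerBlock s H) (11 + n) w ((11 + n) * q + j) =
      (bif w q then H.2 else H.1).testBit j := by
  rw [uniformImage_mul_add _ _ _ (by omega), headerBlock, if_pos hj]

/-- Since `32 ∣ s + n`, the last 32 letters before a header form an aligned Thue–Morse block, fixed
up to complement by one letter; the window uses the last 30 of them. -/
theorem uniformImage_headerBlock_window (hs : s < 32) (hn : 33 ≤ n) (hsn : 32 ∣ s + n)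
    (hH : ∀ c : Bool, (bif c then H.2 else H.1) < 2 ^ 11)
    (w : ℕ → Bool) {q z d : ℕ} (hd : d < 71) (hz : z + 30 = (11 + n) * q + d) :
    uniformImage (headerBlock s H) (11 + n) w z =
      (headerWindow s (thueMorse ((s + n) / 32 - 1)) (bif w q then H.2 else H.1)).testBit d := by
  rcases lt_or_ge d 30 with h | h
  · rw [testBit_headerWindow_left _ _ _ h]
    obtain ⟨q, rfl⟩ : ∃ r, q = r + 1 := ⟨q - 1, by
      rcases q with _ | q
      · omega
      · omega⟩
    rw [Nat.mul_add] at hz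
    rw [show z = (11 + n) * q + 11 + (n - 30 + d) by omega,
      uniformImage_headerBlock_tail _ _ (by omega),
      show s + (n - 30 + d) = 2 ^ 5 * ((s + n) / 32 - 1) + (d + 2) by omega,
      thueMorse_two_pow_mul_add _ _ _ (by omega)]
  · rcases lt_or_ge d 41 with h' | h'
    · obtain ⟨j, rfl⟩ : ∃ j, d = 30 + j := ⟨d - 30, by omega⟩
      rw [testBit_headerWindow_middle _ _ (hH _) (by omega),
        show z = (11 + n) * q + j by omega, uniformImage_headerBlock_head _ _ (by omega)]
    · obtain ⟨j, rfl⟩ : ∃ j, d = 41 + j := ⟨d - 41, by omega⟩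
      rw [testBit_headerWindow_right hs _ (hH _) (by omega),
        show z = (11 + n) * q + 11 + j by omega, uniformImage_headerBlock_tail _ _ (by omega)]

/-- Inside the Thue–Morse part of a block there is no overlap. -/
theorem not_overlap_uniformImage_headerBlock (w : ℕ → Bool) {q p z : ℕ} (hp : 0 < p)
    (hz : (11 + n) * q + 11 ≤ z) (hz' : z + 2 * p < (11 + n) * q + (11 + n)) :
    ∃ j ≤ p, uniformImage (headerBlock s H) (11 + n) w (z + j) ≠
      uniformImage (headerBlock s H) (11 + n) w (z + j + p) := by
  obtain ⟨e, rfl⟩ := Nat.exists_eq_add_of_le hz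
  obtain ⟨j, hj, hne⟩ := thueMorse_not_overlap p (s + e) hp
  refine ⟨j, hj, ?_⟩
  rwa [add_assoc _ e j, add_assoc _ (e + j) p, uniformImage_headerBlock_tail _ _ (by omega),
    uniformImage_headerBlock_tail _ _ (by omega), ← add_assoc, ← add_assoc, ← add_assoc]

theorem cubefreeBelow_uniformImage_headerBlock (hs : s < 32) (hn : 33 ≤ n) (hsn : 32 ∣ s + n)
    (hc : headerCheck s (thueMorse ((s + n) / 32 - 1)) H = true) {w : ℕ → Bool} {N : ℕ}
    (hw : CubefreeBelow w N) :
    CubefreeBelow (uniformImage (headerBlock s H) (11 + n) w) ((11 + n) * N) := by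
  simp only [headerCheck, Bool.and_eq_true, decide_eq_true_eq, List.all_eq_true, List.any_eq_true,
    List.mem_range, Bool.or_eq_true, bne_iff_ne, beq_iff_eq] at hc
  obtain ⟨⟨⟨⟨⟨h1, h2⟩, hne⟩, hM⟩, o, ho, u, hu, hov⟩, hwin⟩ := hc
  have hH : ∀ c : Bool, (bif c then H.2 else H.1) < 2 ^ 11 := by
    intro c; cases c <;> assumption
  have hMc : ∀ c : Bool, bitSlice (bif c then H.2 else H.1) 0 7 = bitSlice H.1 0 7 := by
    intro c; cases c
    · rfl
    · exact hM.symm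
  have hwin' : ∀ c : Bool, _ := fun c => hwin (bif c then H.2 else H.1) (by cases c <;> simp)
  have window := fun {q z d : ℕ} => @uniformImage_headerBlock_window s n H hs hn hsn hH w q z d
  obtain ⟨d, hd, hne⟩ := exists_testBit_ne h1 h2 hne
  have hblock : ∃ d < 11 + n, headerBlock s H false d ≠ headerBlock s H true d :=
    ⟨d, by omega, by simpa [headerBlock, hd] using hne⟩
  have tail := fun {q p z : ℕ} => @not_overlap_uniformImage_headerBlock s n H w q p z
  have marker : ∀ q, ∀ j < 7, uniformImage (headerBlock s H) (11 + n) w ((11 + n) * q + j) =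
      H.1.testBit j := fun q j hj => by
    rw [uniformImage_headerBlock_head _ _ (by omega), bitSlice_zero_ext (hMc _) hj]
  set g := uniformImage (headerBlock s H) (11 + n) w with hg
  -- A stretch either meets a header or lies in one Thue–Morse part. If it meets a header and has at
  -- most 30 letters, the 30 letters kept on each side suffice.
  have near : ∀ i l, 0 < l → (∃ q, i < (11 + n) * q + 11 ∧ (11 + n) * q < i + l) ∨
      ∃ q, (11 + n) * q + 11 ≤ i ∧ i + l ≤ (11 + n) * q + (11 + n) := by
    intro i l hl
    have h3 := Nat.div_add_mod i (11 + n)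
    have h4 : i % (11 + n) < 11 + n := Nat.mod_lt _ (by omega)
    by_contra! h
    obtain ⟨h5, h6⟩ := h
    have h7 := h5 (i / (11 + n))
    have h8 := h5 (i / (11 + n) + 1)
    have h9 := h6 (i / (11 + n))
    rw [Nat.mul_add] at h8
    omega
  have occurrence : ∀ z, (∀ j < 7, g (z + j) = H.1.testBit j) → (11 + n) ∣ z := by
    intro z hz
    rcases near z 7 (by omega) with ⟨q, hq, hq'⟩ | ⟨q, hq, hq'⟩
    · rcases (hwin' (w q)).2 (z + 30 - (11 + n) * q) (by omega) with h | h
      · exact ⟨q, by omega⟩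
      · refine absurd ?_ h
        rw [hMc, bitSlice_eq_iff]
        intro j hj
        rw [← window (by omega) (show z + j + 30 = _ by omega), hz j hj, zero_add]
    · rw [bitSlice_eq_iff] at hov
      obtain ⟨j, hj, hne⟩ := tail (q := q) (p := o + 1) (z := z + u) (by omega) (by omega)
        (by omega)
      refine absurd ?_ hne
      rw [add_assoc, add_assoc, hz _ (by omega), hz _ (by omega), hov j (by omega)]
      congr 1
      omega
  intro p i hp hi hcube
  rcases le_or_gt p 10 with hp10 | hp10
  · rcases near i (3 * p) (by omega) with ⟨q, hq, hq'⟩ | ⟨q, hq, hq'⟩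
    · refine cubefreeBits_iff.mp (hwin' (w q)).1 p (i + 30 - (11 + n) * q) hp hp10 (by omega)
        (hcube.congr fun j hj => ?_)
      exact window (by omega) (by omega)
    · obtain ⟨j, hj, hne⟩ := tail hp hq (show i + 2 * p < _ by omega)
      exact hne (hcube j (by omega))
  · by_cases hq : ∃ q, i ≤ (11 + n) * q ∧ (11 + n) * q + 7 ≤ i + 3 * p
    · obtain ⟨q, hq, hq'⟩ := hq
      refine not_isCubeAt_uniformImage_of_dvd hblock hw hp hi ?_ hcube
      -- The marker is copied one period to the right if it ends within the first two periods,
      -- otherwise one period to the left.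
      by_cases hq2 : (11 + n) * q + 7 ≤ i + 2 * p
      · refine (Nat.dvd_add_right (Dvd.intro q rfl)).mp (occurrence ((11 + n) * q + p) ?_)
        intro j hj
        have := hcube ((11 + n) * q - i + j) (by omega)
        rw [show i + ((11 + n) * q - i + j) = (11 + n) * q + j by omega, add_right_comm] at this
        rw [← this, marker q j hj]
      · refine (Nat.dvd_sub_iff_right (by omega) (Dvd.intro q rfl)).mp
          (occurrence ((11 + n) * q - p) ?_)
        intro j hj
        have := hcube ((11 + n) * q - p - i + j) (by omega)
        rw [show i + ((11 + n) * q - p - i + j) + p = (11 + n) * q + j by omega,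
          show i + ((11 + n) * q - p - i + j) = (11 + n) * q - p + j by omega] at this
        rw [this, marker q j hj]
    -- No whole marker lies in the cube, so it ends before the seventh letter of the next block is
    -- complete.
    · push Not at hq
      have h3 := Nat.div_add_mod i (11 + n)
      have h4 : i % (11 + n) < 11 + n := Nat.mod_lt _ (by omega)
      have h7 := hq (i / (11 + n))
      have h8 := hq (i / (11 + n) + 1)
      rw [Nat.mul_add] at h8
      rcases le_or_gt ((11 + n) * (i / (11 + n)) + 11) i with h | h
      · obtain ⟨j, hj, hne⟩ := tail (q := i / (11 + n)) hp h (by omega)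
        exact hne (hcube j (by omega))
      -- The cube starts inside a header but after its first letter, so `3 * p ≤ k + 5` with `k = 11
      -- + n`; then `11 + 2 * p < k` holds because `k ≥ 44`. At most 10 header letters are dropped,
      -- fewer than `p`, so an overlap remains in the Thue–Morse part.
      · obtain ⟨j, hj, hne⟩ := tail (q := i / (11 + n)) hp le_rfl (by omega)
        have := hcube ((11 + n) * (i / (11 + n)) + 11 - i + j) (by omega)
        rw [show i + ((11 + n) * (i / (11 + n)) + 11 - i + j) =
          (11 + n) * (i / (11 + n)) + 11 + j by omega] at this
        exact hne this

end

/-! ### Translation to free monoids -/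

/-- The letters of a word, with `false` for `0` and `true` for `1`, continued by `false`. -/
def letters (u : FreeMonoid (Fin 2)) (i : ℕ) : Bool :=
  finTwoEquiv (u.toList.getD i 0)

theorem isCubefreeWord_iff {u : FreeMonoid (Fin 2)} :
    IsCubefreeWord u ↔ CubefreeBelow (letters u) u.length := by
  have hlen : ∀ v : FreeMonoid (Fin 2), v.length = v.toList.length := fun _ => rfl
  constructor
  · intro h p i hp hi hc
    have hi' : i + 3 * p ≤ u.toList.length := hi
    have hget : ∀ j < 2 * p, u.toList[i + j]? = u.toList[i + j + p]? := by
      intro j hj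
      have := finTwoEquiv.injective (hc j hj)
      rw [List.getD_eq_getElem _ _ (by omega), List.getD_eq_getElem _ _ (by omega)] at this
      rw [List.getElem?_eq_getElem (by omega), List.getElem?_eq_getElem (by omega), this]
    set x := (u.toList.drop i).take p with hx
    have hxl : x.length = p := by simp [hx]; omega
    have e1 : (u.toList.drop (i + p)).take p = x := by
      refine List.ext_getElem? fun j => ?_
      by_cases hj : j < p
      · simp only [hx, List.getElem?_take, hj, if_true, List.getElem?_drop]
        rw [hget j (by omega), add_right_comm]
      · simp [hx, hj]
    have e2 : (u.toList.drop (i + p + p)).take p = x := by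
      rw [← e1]
      refine List.ext_getElem? fun j => ?_
      by_cases hj : j < p
      · simp only [List.getElem?_take, hj, if_true, List.getElem?_drop]
        rw [add_assoc i p j, hget (p + j) (by omega)]
        congr 1
        omega
      · simp [hj]
    have split : ∀ i, u.toList.drop i = (u.toList.drop i).take p ++ u.toList.drop (i + p) := by
      intro i
      rw [← List.drop_drop, List.take_append_drop]
    have hu : u.toList = u.toList.take i ++ (x ++ x ++ x) ++ u.toList.drop (i + p + p + p) := by
      conv_lhs => rw [← List.take_append_drop i u.toList, split i, split (i + p),
        split (i + p + p), e1, e2]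
      simp [hx]
    refine h (FreeMonoid.ofList (x ++ x ++ x))
      ⟨FreeMonoid.ofList (u.toList.take i), FreeMonoid.ofList (u.toList.drop (i + p + p + p)), ?_⟩
      ⟨?_, FreeMonoid.ofList x, rfl⟩
    · exact hu
    · intro h1
      have := congrArg FreeMonoid.length h1
      simp only [hlen, FreeMonoid.toList_ofList, FreeMonoid.toList_one, List.length_append,
        hxl, List.length_nil] at this
      omega
  · rintro h v ⟨a, b, rfl⟩ ⟨hv, x, rfl⟩
    have hx : 0 < x.toList.length := by
      rw [List.length_pos_iff]
      intro h0
      apply hv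
      have : x = 1 := FreeMonoid.toList.injective h0
      simp [this]
    refine h x.toList.length a.toList.length hx ?_ ?_
    · simp only [hlen, FreeMonoid.toList_mul, List.length_append]
      omega
    · intro j hj
      simp only [letters, FreeMonoid.toList_mul, List.append_assoc, List.getD_eq_getElem?_getD]
      rw [add_assoc]
      conv_lhs => rw [List.getElem?_append_right (by omega), Nat.add_sub_cancel_left]
      conv_rhs => rw [List.getElem?_append_right (by omega), Nat.add_sub_cancel_left,
        List.getElem?_append_right (by omega), Nat.add_sub_cancel]
      rcases lt_or_ge j x.toList.length with h1 | h1
      · rw [List.getElem?_append_left h1, List.getElem?_append_left h1]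
      · rw [List.getElem?_append_right h1, List.getElem?_append_right h1,
          List.getElem?_append_left (by omega), List.getElem?_append_left (by omega)]

/-- The `k`-uniform morphism that sends a letter `c` to the first `k` letters of `A c`. -/
def uniformMorphism (A : Bool → ℕ → Bool) (k : ℕ) :
    FreeMonoid (Fin 2) →* FreeMonoid (Fin 2) :=
  FreeMonoid.lift fun c =>
    FreeMonoid.ofList ((List.range k).map fun d => finTwoEquiv.symm (A (finTwoEquiv c) d))

theorem toList_uniformMorphism (A : Bool → ℕ → Bool) (k : ℕ) (u : FreeMonoid (Fin 2)) :
    (uniformMorphism A k u).toList.length = k * u.toList.length ∧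
      ∀ i < k * u.toList.length,
        letters (uniformMorphism A k u) i = uniformImage A k (letters u) i := by
  induction u using FreeMonoid.inductionOn' with
  | one => simp
  | of_mul c u ih =>
    have hof : uniformMorphism A k (FreeMonoid.of c) =
      FreeMonoid.ofList ((List.range k).map fun d => finTwoEquiv.symm (A (finTwoEquiv c) d)) := by
      rw [uniformMorphism, FreeMonoid.lift_eval_of]
    obtain ⟨ih1, ih2⟩ := ih
    refine ⟨?_, fun i hi => ?_⟩
    · simp [hof, ih1]
      ring
    · simp only [FreeMonoid.toList_mul, FreeMonoid.toList_of, List.length_append,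
        List.length_singleton] at hi
      rw [Nat.mul_add, mul_one] at hi
      rcases lt_or_ge i k with h | h
      · simp [letters, uniformImage, hof, List.getD_eq_getElem?_getD, List.getElem?_append_left,
          h, Nat.div_eq_of_lt h, Nat.mod_eq_of_lt h]
      · obtain ⟨j, rfl⟩ := Nat.exists_eq_add_of_le h
        have hk : 0 < k := by
          rcases Nat.eq_zero_or_pos k with h0 | h0
          · subst h0; omega
          · exact h0
        have e1 : letters (uniformMorphism A k (FreeMonoid.of c * u)) (k + j) =
            letters (uniformMorphism A k u) j := by
          simp [letters, hof, List.getD_eq_getElem?_getD, List.getElem?_append_right]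
        rw [e1, ih2 j (by omega), uniformImage, uniformImage, Nat.add_div_left _ hk,
          Nat.add_mod_left]
        simp [letters]

theorem isUniformMorphism_uniformMorphism (A : Bool → ℕ → Bool) (k : ℕ) :
    IsUniformMorphism k (uniformMorphism A k) := by
  intro c
  exact (toList_uniformMorphism A k (FreeMonoid.of c)).1.trans (mul_one k)

theorem isCubefreeMorphism_uniformMorphism {A : Bool → ℕ → Bool} {k : ℕ}
    (h : ∀ w n, CubefreeBelow w n → CubefreeBelow (uniformImage A k w) (k * n)) :
    IsCubefreeMorphism (uniformMorphism A k) := by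
  intro u hu
  obtain ⟨h1, h2⟩ := toList_uniformMorphism A k u
  rw [isCubefreeWord_iff] at hu ⊢
  intro p i hp hi hc
  have hi' : i + 3 * p ≤ k * u.toList.length := by rw [← h1]; exact hi
  refine h _ _ hu p i hp hi' (hc.congr fun j hj => h2 _ (by omega))

theorem length_map_of_isUniformMorphism {k : ℕ} {h : FreeMonoid (Fin 2) →* FreeMonoid (Fin 2)}
    (hh : IsUniformMorphism k h) (u : FreeMonoid (Fin 2)) : (h u).length = k * u.length := by
  induction u using FreeMonoid.inductionOn' with
  | one => simp
  | of_mul c u ih => rw [map_mul, FreeMonoid.length_mul, hh, ih, FreeMonoid.length_mul,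
      FreeMonoid.length_of]; ring

/-! ### Products, small primes and conclusion -/

/-- There is a `k`-uniform cubefree morphism on binary words. -/
def HasUniformCubefree (k : ℕ) : Prop :=
  ∃ h : FreeMonoid (Fin 2) →* FreeMonoid (Fin 2), IsUniformMorphism k h ∧ IsCubefreeMorphism h

theorem HasUniformCubefree.mul {k l : ℕ} (hk : HasUniformCubefree k)
    (hl : HasUniformCubefree l) : HasUniformCubefree (k * l) := by
  obtain ⟨f, hf, hf'⟩ := hk
  obtain ⟨g, hg, hg'⟩ := hl
  refine ⟨f.comp g, fun c => ?_, fun w hw => hf' _ (hg' _ hw)⟩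
  rw [MonoidHom.comp_apply, length_map_of_isUniformMorphism hf, hg]

theorem hasUniformCubefree_of_check {k : ℕ} (m L M a b : ℕ) (hm : 0 < m)
    (hL : k + 3 * m ≤ k * L + 4) (hL' : k + m ≤ k * M + 1)
    (h : uniformCheck k m L M a b = true) : HasUniformCubefree k :=
  ⟨_, isUniformMorphism_uniformMorphism _ _, isCubefreeMorphism_uniformMorphism fun _ _ hw =>
    cubefreeBelow_uniformImage_of_check hm hL hL' h hw⟩

theorem hasUniformCubefree_of_le {k : ℕ} (hk : 44 ≤ k) : HasUniformCubefree k := by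
  obtain ⟨n, rfl⟩ := Nat.exists_eq_add_of_le (show 11 ≤ k by omega)
  -- This start makes the Thue–Morse factor of length `n` end at a multiple of 32.
  have hs : (32 - n % 32) % 32 < 32 := Nat.mod_lt _ (by norm_num)
  obtain ⟨H, -, hH⟩ := exists_headerCheck _ hs
    (thueMorse (((32 - n % 32) % 32 + n) / 32 - 1))
  exact ⟨_, isUniformMorphism_uniformMorphism _ _, isCubefreeMorphism_uniformMorphism fun _ _ hw =>
    cubefreeBelow_uniformImage_headerBlock hs (by omega) (by omega) hH hw⟩

theorem hasUniformCubefree_zero : HasUniformCubefree 0 := by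
  refine ⟨1, fun _ => rfl, fun w _ u hu hc => ?_⟩
  obtain ⟨p, s, h⟩ := hu
  have := congrArg FreeMonoid.length h
  rw [MonoidHom.one_apply, FreeMonoid.length_one, FreeMonoid.length_mul,
    FreeMonoid.length_mul] at this
  exact hc.1 (FreeMonoid.length_eq_zero.mp (by omega))

theorem hasUniformCubefree_one : HasUniformCubefree 1 :=
  ⟨MonoidHom.id _, fun _ => rfl, fun _ hw => hw⟩

/-- Rows `k, m, L, M, a, b` that pass `uniformCheck`, one for each prime `k` below 44. -/
def primeTable : List (ℕ × ℕ × ℕ × ℕ × ℕ × ℕ) :=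
  [(2, 4, 5, 3, 2, 1),
    (3, 3, 3, 3, 4, 6),
    (5, 6, 4, 2, 18, 13),
    (7, 7, 4, 2, 100, 108),
    (11, 9, 4, 2, 1626, 1618),
    (13, 8, 3, 2, 2483, 1459),
    (17, 8, 3, 2, 76204, 92588),
    (19, 10, 3, 2, 445860, 445604),
    (23, 11, 3, 2, 5851573, 5851557),
    (29, 14, 3, 2, 154572395, 154506859),
    (31, 15, 3, 2, 748267082, 748250698),
    (37, 18, 3, 2, 79806515813, 79806516069),
    (41, 20, 3, 2, 646848295769, 646848263001),
    (43, 21, 3, 2, 5112515959090, 5181235435826)]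

theorem uniformCheck_primeTable : ∀ x ∈ primeTable,
    0 < x.2.1 ∧ x.1 + 3 * x.2.1 ≤ x.1 * x.2.2.1 + 4 ∧ x.1 + x.2.1 ≤ x.1 * x.2.2.2.1 + 1 ∧
      uniformCheck x.1 x.2.1 x.2.2.1 x.2.2.2.1 x.2.2.2.2.1 x.2.2.2.2.2 = true := by
  decide +kernel

theorem exists_mem_primeTable :
    ∀ p < 44, p.Prime → ∃ x ∈ primeTable, x.1 = p := by
  decide +kernel

theorem hasUniformCubefree_of_prime {p : ℕ} (hp : p.Prime) (hlt : p < 44) :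
    HasUniformCubefree p := by
  obtain ⟨x, hx, rfl⟩ := exists_mem_primeTable p hlt hp
  obtain ⟨h1, h2, h3, h4⟩ := uniformCheck_primeTable x hx
  exact hasUniformCubefree_of_check _ _ _ _ _ h1 h2 h3 h4

theorem hasUniformCubefree (k : ℕ) : HasUniformCubefree k := by
  induction k using induction_on_primes with
  | zero => exact hasUniformCubefree_zero
  | one => exact hasUniformCubefree_one
  | prime_mul p a hp ha =>
    refine HasUniformCubefree.mul ?_ ha
    rcases lt_or_ge p 44 with h | h
    · exact hasUniformCubefree_of_prime hp h
    · exact hasUniformCubefree_of_le h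

theorem mainTheorem2 (k : ℕ) :
    ∃ h : FreeMonoid (Fin 2) →* FreeMonoid (Fin 2),
      IsUniformMorphism k h ∧ IsCubefreeMorphism h :=
  hasUniformCubefree k
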